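/- For $n\in\mathbb N$ let $N=2^n$ and $M=2N$. For $f,g:\{0,1\}^n\to\{-1,1\}$ put $$\Phi_{f,g}=\frac1{2^{3n/2}}\sum_{x,y\in\{0,1\}^n}f(x)(-1)^{x\cdot y}g(y).$$ Pairs $\langle f,g\rangle$ are identified with strings in $\{-1,1\}^M$, and with strings in $\{0,1\}^M$ through $x\mapsto\frac{1+x}{2}$. Let $\mathcal U$ be the uniform distribution on such pairs. Let $\mathcal F$ be the distribution of $\langle f,g\rangle$ where $v=(v_x)_{x\in\{0,1\}^n}$ has independent standard Gaussian entries, $f(x)=\operatorname{sgn}(v_x)$ and $g(y)=\operatorname{sgn}(\widehat v_y)$ with $\widehat v_y=\frac1{\sqrt N}\sum_{x}(-1)^{x\cdot y}v_x$, and $\operatorname{sgn}(\alpha)=1$ if $\alpha\ge 0$, $\operatorname{sgn}(\alpha)=-1$ if $\alpha<0$. Let $\mathcal F'$ be $\mathcal F$ conditioned on $\Phi_{f,g}\ge 0.07$, and let $\mathcal U'$ be $\mathcal U$ conditioned on $|\Phi_{f,g}|\le 0.01$. A $k$-term $C$ is a product of $k$ literals $z_i$ or $1-z_i$ in $k$ different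 variables $z_i$ of a string $z\in\{0,1\}^M$. A distribution $\mathcal D$ on $\{0,1\}^M$ is $\varepsilon$-almost $k$-wise independent if $1-\varepsilon\le \Pr_{\mathcal D}[C=1]/\Pr_{\mathcal U}[C=1]\le 1+\varepsilon$ for every $k$-term $C$. **Lemma.** Let $k=k(n)$ be natural numbers with $k\le N^{o(1)}$, that is, $k(n)\le N^{\delta(n)}$ for all large $n$ and some real sequence $\delta(n)\to 0$. Then there is a real sequence $\varepsilon(n)\to0$ such that for all sufficiently large $n$ both conditioning events have positive probability (so that $\mathcal F'$ and $\mathcal U'$ are well defined) and $\mathcal F'$ and $\mathcal U'$ are $\varepsilon(n)$-almost $k(n)$-wise independent. -/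

import Mathlib

open scoped Topology

namespace Forrelation

noncomputable section

/-! Almost `k`-wise independence of distributions over `{0,1}^ι`, for a finite index set `ι`.
Bits are Booleans, with `true` for `1` and `false` for `0`. -/

/-- A `k`-term over the variables `z i`, `i : ι`: a product of `k` literals that involve the
`k` different variables in `vars`. The literal of the variable `z i` is `z i` if `val i = true` and
`1 - z i` if `val i = false` (the values of `val` outside `vars` play no role). -/
structure KTerm (ι : Type*) (k : ℕ) where
  vars : Finset ι
  card_vars : vars.card = k
  val : ι → Bool

/-- The event that the term takes the value `1`, that is, that all variables of the term take on
their prescribed values. -/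
def KTerm.event {ι : Type*} {k : ℕ} (C : KTerm ι k) : Set (ι → Bool) :=
  {z | ∀ i ∈ C.vars, z i = C.val i}

/-- The uniform distribution over `{0,1}^ι`. -/
def uniform (ι : Type*) : MeasureTheory.Measure (ι → Bool) :=
  ProbabilityTheory.uniformOn Set.univ

/-- `D` is `ε`-almost `k`-wise independent: `1 - ε ≤ Pr_D[C] / Pr_U[C] ≤ 1 + ε` for every `k`-term
`C`, with `U` the uniform distribution. -/
def AlmostKWiseIndependent {ι : Type*} (D : MeasureTheory.Measure (ι → Bool)) (ε : ℝ) (k : ℕ) :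
    Prop :=
  ∀ C : KTerm ι k,
    1 - ε ≤ D.real C.event / (uniform ι).real C.event ∧
      D.real C.event / (uniform ι).real C.event ≤ 1 + ε

/-! The forrelation quantity and the input distributions. -/

/-- The cube `{0,1}^n`. -/
abbrev Cube (n : ℕ) : Type := Fin n → Bool

/-- The inner product `x · y` (its parity is all that matters). -/
def dot {n : ℕ} (x y : Cube n) : ℕ := ∑ i, (x i).toNat * (y i).toNat

/-- The index set of the input strings; it has `M = 2 * 2^n` elements. -/
abbrev Index (n : ℕ) : Type := Cube n ⊕ Cube n

/-- The element of `{-1,1}` that is encoded by a bit: the inverse of `x ↦ (1 + x) / 2`. -/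
def spin (b : Bool) : ℝ := if b then 1 else -1

/-- `Φ_{f,g} = 2^{-3n/2} ∑_{x,y} f(x) (-1)^{x·y} g(y)`. -/
def phi {n : ℕ} (f g : Cube n → ℝ) : ℝ :=
  1 / (2 : ℝ) ^ (3 * (n : ℝ) / 2) * ∑ x, ∑ y, f x * (-1) ^ dot x y * g y

/-- `Φ_{f,g}` for the pair of functions `f, g : {0,1}^n → {-1,1}` encoded by the bit string `z`,
with `f` in the first half of `z` and `g` in the second half. -/
def phiString {n : ℕ} (z : Index n → Bool) : ℝ :=
  phi (fun x => spin (z (Sum.inl x))) (fun y => spin (z (Sum.inr y)))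

/-- The Fourier transform over `ℤ₂^n`: `v̂_y = N^{-1/2} ∑_x (-1)^{x·y} v_x` with `N = 2^n`. -/
def fourierTransform {n : ℕ} (v : Cube n → ℝ) (y : Cube n) : ℝ :=
  1 / √((2 : ℝ) ^ n) * ∑ x, (-1) ^ dot x y * v x

/-- The bit that encodes `sgn a`, where `sgn a = 1` if `a ≥ 0` and `sgn a = -1` if `a < 0`. -/
def sgnBit (a : ℝ) : Bool := decide (0 ≤ a)

theorem spin_sgnBit (a : ℝ) : spin (sgnBit a) = if 0 ≤ a then 1 else -1 := by
  simp [spin, sgnBit]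

/-- The string of the pair `f = sgn v`, `g = sgn v̂`. -/
def forrelatedString {n : ℕ} (v : Cube n → ℝ) : Index n → Bool :=
  Sum.elim (fun x => sgnBit (v x)) (fun y => sgnBit (fourierTransform v y))

theorem measurable_sgnBit : Measurable sgnBit :=
  measurable_to_bool (by
    have h : sgnBit ⁻¹' {true} = Set.Ici 0 := by ext; simp [sgnBit]
    rw [h]; exact measurableSet_Ici)

theorem measurable_forrelatedString (n : ℕ) : Measurable (forrelatedString (n := n)) := by
  refine measurable_pi_lambda _ ?_
  rintro (x | y)
  · exact measurable_sgnBit.comp (measurable_pi_apply x)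
  · refine measurable_sgnBit.comp (g := sgnBit) (f := fun v => fourierTransform v y) ?_
    unfold fourierTransform
    fun_prop

/-- The forrelated distribution `𝓕`: the law of the pair `(sgn v, sgn v̂)` when the entries of `v`
are independent standard Gaussians. -/
def forrelated (n : ℕ) : MeasureTheory.Measure (Index n → Bool) :=
  (MeasureTheory.Measure.pi fun _ : Cube n => ProbabilityTheory.gaussianReal 0 1).map
    forrelatedString

/-- `𝓕'`: the forrelated distribution conditioned on `Φ ≥ 0.07`. -/
def forrelatedCond (n : ℕ) : MeasureTheory.Measure (Index n → Bool) :=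
  ProbabilityTheory.cond (forrelated n) {z | 0.07 ≤ phiString z}

/-- `𝓤'`: the uniform distribution conditioned on `|Φ| ≤ 0.01`. -/
def uniformCond (n : ℕ) : MeasureTheory.Measure (Index n → Bool) :=
  ProbabilityTheory.cond (uniform (Index n)) {z | |phiString z| ≤ 0.01}

end

end Forrelation

namespace Forrelation

noncomputable section

open MeasureTheory ProbabilityTheory

/-! Both distributions are almost `k`-wise independent before conditioning, and both conditioning
events fail with probability exponentially small in `N`. Conditioning changes the probability of a
term by an absolute amount of that order, hence changes its ratio to `2⁻ᵏ` by at most about `2ᵏ`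
times as much; this is negligible because `k` is far below `N` (`AlmostKWiseIndependent.cond`).

For the forrelated distribution, the `k` bits of a term are signs of a Gaussian vector whose
covariance has unit diagonal and off-diagonal entries `0` or `±N^(-1/2)`. Such a covariance differs
from the identity by at most `k N^(-1/2)` in operator norm. Its density is therefore squeezed
between multiples of two isotropic Gaussian densities, under each of which every orthant has
probability exactly `2⁻ᵏ`. This gives a relative error of order `k² N^(-1/2)`
(`abs_orthant_sub_one_le`).

For the conditioning events, `Φ` under the uniform distribution is, given `g`, a Rademacher sum, so
an exponential moment bounds its tail (`uniform_abs_phiString_compl_le`). Under the forrelated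
distribution, `v` is Gaussian and so is its transform; each lies close to a multiple of its sign
vector, and Parseval turns this closeness into a lower bound on `Φ`
(`le_phiString_forrelatedString`). The sums of squared distances are controlled by a Chernoff bound
(`exists_signError_tail`). -/

/-! ### Linear images of Gaussian vectors -/

/-- The law of a vector of independent standard Gaussians. -/
abbrev stdGaussianPi (ι : Type*) [Fintype ι] : Measure (ι → ℝ) :=
  Measure.pi fun _ => gaussianReal 0 1

lemma charFunDual_stdGaussianPi {ι : Type*} [Fintype ι] [DecidableEq ι]
    (L : StrongDual ℝ (ι → ℝ)) :
    charFunDual (stdGaussianPi ι) L =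
      Complex.exp (-((∑ i, L (Pi.single i 1) ^ 2 : ℝ) : ℂ) / 2) := by
  rw [charFunDual_pi]
  have h : ∀ i, charFunDual (gaussianReal 0 1) (L ∘SL ContinuousLinearMap.single ℝ (fun _ => ℝ) i)
      = Complex.exp (-((L (Pi.single i 1) ^ 2 : ℝ) : ℂ) / 2) := by
    intro i
    have e : (L ∘SL ContinuousLinearMap.single ℝ (fun _ : ι => ℝ) i : StrongDual ℝ ℝ) =
        (L (Pi.single i 1)) • ContinuousLinearMap.id ℝ ℝ := by
      ext; simp
    rw [charFunDual_eq_charFun_map_one, e]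
    have e2 : ⇑((L (Pi.single i 1)) • ContinuousLinearMap.id ℝ ℝ) =
        fun x => L (Pi.single i 1) * x := by ext; simp
    rw [e2, gaussianReal_map_const_mul, charFun_gaussianReal]
    congr 1
    push_cast
    simp [neg_div]
  rw [Finset.prod_congr rfl fun i _ => h i, ← Complex.exp_sum]
  congr 1
  push_cast
  rw [← Finset.sum_neg_distrib, Finset.sum_div]

lemma charFunDual_map_mulVec_stdGaussianPi {ι κ : Type*} [Fintype ι] [Fintype κ] [DecidableEq κ]
    (M : Matrix κ ι ℝ) (F : StrongDual ℝ (κ → ℝ)) :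
    charFunDual ((stdGaussianPi ι).map (fun v => M.mulVec v)) F =
      Complex.exp (-((∑ a, ∑ b, F (Pi.single a 1) * F (Pi.single b 1) *
        (M * M.transpose) a b : ℝ) : ℂ) / 2) := by
  classical
  have e : (fun v => M.mulVec v) = ⇑(LinearMap.toContinuousLinearMap (Matrix.mulVecLin M)) := by
    ext; simp
  rw [e, charFunDual_map, charFunDual_stdGaussianPi]
  congr 4
  have hF : ∀ w : κ → ℝ, F w = ∑ a, w a * F (Pi.single a 1) := by
    intro w
    conv_lhs => rw [pi_eq_sum_univ' w]
    simp [map_sum]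
  have : ∀ i, (F ∘SL (LinearMap.toContinuousLinearMap (Matrix.mulVecLin M)))
      (Pi.single i 1) = ∑ a, M a i * F (Pi.single a 1) := by
    intro i
    simp only [ContinuousLinearMap.comp_apply, LinearMap.coe_toContinuousLinearMap',
      Matrix.mulVecLin_apply]
    rw [hF]
    simp
  simp_rw [this, sq, Finset.sum_mul_sum, Matrix.mul_apply, Matrix.transpose_apply,
    Finset.mul_sum]
  rw [Finset.sum_comm]
  refine Finset.sum_congr rfl fun a _ => ?_
  rw [Finset.sum_comm]
  refine Finset.sum_congr rfl fun b _ => Finset.sum_congr rfl fun i _ => by ring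

/-- The law of `L *ᵥ v` for a standard Gaussian vector `v` depends only on `L * Lᵀ`. -/
lemma map_mulVec_stdGaussianPi_congr {ι κ τ : Type*} [Fintype ι] [Fintype κ] [Fintype τ]
    (L : Matrix κ ι ℝ) (A : Matrix κ τ ℝ) (h : L * L.transpose = A * A.transpose) :
    (stdGaussianPi ι).map (fun v => L.mulVec v) = (stdGaussianPi τ).map (fun v => A.mulVec v) := by
  classical
  apply Measure.ext_of_charFunDual
  ext F
  rw [charFunDual_map_mulVec_stdGaussianPi, charFunDual_map_mulVec_stdGaussianPi, h]

/-! ### Signs of nearly uncorrelated Gaussians -/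

lemma pi_gaussianReal_eq_withDensity {ι : Type*} [Fintype ι] {v : NNReal} (hv : v ≠ 0) :
    (Measure.pi fun _ : ι => gaussianReal 0 v) = volume.withDensity fun u =>
      ENNReal.ofReal ((√(2 * Real.pi * v))⁻¹ ^ Fintype.card ι *
        Real.exp (-(∑ i, u i ^ 2) / (2 * v))) := by
  have hd : ∀ u : ι → ℝ, (√(2 * Real.pi * v))⁻¹ ^ Fintype.card ι *
        Real.exp (-(∑ i, u i ^ 2) / (2 * v)) = ∏ i, gaussianPDFReal 0 v (u i) := by
    intro u
    simp only [gaussianPDFReal, Finset.prod_mul_distrib, Finset.prod_const, Finset.card_univ,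
      ← Real.exp_sum, sub_zero, ← Finset.sum_div, Finset.sum_neg_distrib]
  simp_rw [hd]
  symm
  refine (Measure.pi_eq fun s hs => ?_).symm
  rw [withDensity_apply _ (MeasurableSet.univ_pi hs), volume_pi, Measure.restrict_pi_pi]
  rw [← ofReal_integral_eq_lintegral_ofReal, integral_fintype_prod_eq_prod,
    ENNReal.ofReal_prod_of_nonneg]
  · refine Finset.prod_congr rfl fun i _ => ?_
    rw [gaussianReal_apply_eq_integral _ hv]
  · intro i _
    exact integral_nonneg fun x => gaussianPDFReal_nonneg _ _ _
  · exact Integrable.fintype_prod fun i => (integrable_gaussianPDFReal 0 v).restrict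
  · exact Filter.Eventually.of_forall fun u =>
      Finset.prod_nonneg fun i _ => gaussianPDFReal_nonneg _ _ _

lemma gaussianReal_sgnBit_preimage {v : NNReal} (hv : v ≠ 0) (b : Bool) :
    gaussianReal 0 v {x | sgnBit x = b} = 2⁻¹ := by
  have := nullSingletonClass_gaussianReal (μ := 0) hv
  have h1 : gaussianReal 0 v (Set.Iio 0) = gaussianReal 0 v (Set.Ici 0) := by
    have := gaussianReal_map_neg (μ := 0) (v := v)
    rw [neg_zero] at this
    conv_rhs => rw [← this, Measure.map_apply measurable_neg measurableSet_Ici]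
    rw [measure_congr Iio_ae_eq_Iic]
    congr 1
    ext; simp
  have h2 : gaussianReal 0 v (Set.Ici 0) + gaussianReal 0 v (Set.Iio 0) = 1 := by
    rw [← Set.compl_Ici, measure_add_measure_compl measurableSet_Ici, measure_univ]
  have h3 : gaussianReal 0 v (Set.Ici 0) = 2⁻¹ := by
    rw [h1, ← two_mul] at h2
    rw [mul_comm] at h2
    exact ENNReal.eq_inv_of_mul_eq_one_left h2
  cases b
  · rw [← h3, ← h1]; congr 1; ext; simp [sgnBit]
  · rw [← h3]; congr 1; ext; simp [sgnBit]

lemma pi_gaussianReal_orthant {ι : Type*} [Fintype ι] {v : NNReal} (hv : v ≠ 0) (val : ι → Bool) :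
    (Measure.pi fun _ : ι => gaussianReal 0 v) {w | ∀ i, sgnBit (w i) = val i} =
      2⁻¹ ^ Fintype.card ι := by
  have : {w : ι → ℝ | ∀ i, sgnBit (w i) = val i} =
      Set.univ.pi fun i => {x | sgnBit x = val i} := by ext; simp
  rw [this, Measure.pi_pi]
  simp [gaussianReal_sgnBit_preimage hv]

lemma measurable_mulVec {ι κ : Type*} [Fintype ι] (M : Matrix κ ι ℝ) :
    Measurable fun u : ι → ℝ => M.mulVec u := by
  refine measurable_pi_lambda _ fun i => ?_
  simp only [Matrix.mulVec, dotProduct]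
  fun_prop

/-- Change of variables `w = A u`. After it, product Gaussians of variance `v` and the law of `A u`
are compared through integrands over the same set. -/
lemma pi_gaussianReal_apply_eq_lintegral_mulVec {κ : Type*} [Fintype κ] [DecidableEq κ]
    {A : Matrix κ κ ℝ} (hA : A.det ≠ 0) {v : NNReal} (hv : v ≠ 0) {s : Set (κ → ℝ)}
    (hs : MeasurableSet s) :
    (Measure.pi fun _ : κ => gaussianReal 0 v) s =
      ENNReal.ofReal |A.det| * ∫⁻ u in (fun u => A.mulVec u) ⁻¹' s,
        ENNReal.ofReal ((√(2 * Real.pi * v))⁻¹ ^ Fintype.card κ *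
          Real.exp (-(∑ i, (A.mulVec u) i ^ 2) / (2 * v))) := by
  have hm := measurable_mulVec A
  have hvol : (volume : Measure (κ → ℝ)) =
      ENNReal.ofReal |A.det| • Measure.map (fun u => A.mulVec u) volume := by
    have h := Real.map_matrix_volume_pi_eq_smul_volume_pi hA
    have e : ⇑(Matrix.toLin' A) = fun u => A.mulVec u := by ext; simp
    rw [e] at h
    rw [h, smul_smul, ← ENNReal.ofReal_mul (abs_nonneg _), ← abs_mul, mul_inv_cancel₀ hA]
    simp
  rw [pi_gaussianReal_eq_withDensity hv, withDensity_apply _ hs]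
  conv_lhs => rw [hvol]
  rw [Measure.restrict_smul, lintegral_smul_measure, setLIntegral_map hs (by fun_prop) hm]
  rfl

/-- Comparison of the law of `A *ᵥ u` with a product of Gaussians of larger variance. -/
lemma map_mulVec_stdGaussianPi_le {κ : Type*} [Fintype κ] [DecidableEq κ]
    {A : Matrix κ κ ℝ} (hA : A.det ≠ 0) {v : NNReal} (hv : v ≠ 0)
    (h : ∀ u, ∑ i, (A.mulVec u) i ^ 2 ≤ v * ∑ i, u i ^ 2) {s : Set (κ → ℝ)}
    (hs : MeasurableSet s) :
    |A.det| * (stdGaussianPi κ).real ((fun u => A.mulVec u) ⁻¹' s) ≤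
      √v ^ Fintype.card κ * (Measure.pi fun _ : κ => gaussianReal 0 v).real s := by
  have hm := measurable_mulVec A
  have key : ENNReal.ofReal |A.det| * (stdGaussianPi κ) ((fun u => A.mulVec u) ⁻¹' s) ≤
      ENNReal.ofReal (√v ^ Fintype.card κ) * (Measure.pi fun _ : κ => gaussianReal 0 v) s := by
    rw [pi_gaussianReal_apply_eq_lintegral_mulVec hA hv hs, stdGaussianPi,
      pi_gaussianReal_eq_withDensity one_ne_zero, withDensity_apply _ (hm hs), mul_left_comm,
      ← lintegral_const_mul' (ENNReal.ofReal (√v ^ Fintype.card κ)) _ ENNReal.ofReal_ne_top]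
    gcongr with u
    rw [← ENNReal.ofReal_mul (by positivity)]
    apply ENNReal.ofReal_le_ofReal
    rw [← mul_assoc, ← mul_pow]
    have hv0 : (0 : ℝ) < v := by positivity
    have e : √v * (√(2 * Real.pi * v))⁻¹ = (√(2 * Real.pi * (1 : NNReal)))⁻¹ := by
      rw [Real.sqrt_mul (by positivity)]
      have : √(v : ℝ) ≠ 0 := by positivity
      field_simp
      simp
    rw [e]
    refine mul_le_mul_of_nonneg_left (Real.exp_le_exp.mpr ?_) (by positivity)
    rw [div_le_div_iff₀ (by simp) (by positivity)]
    push_cast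
    nlinarith [h u]
  have := ENNReal.toReal_mono (by finiteness) key
  simpa [ENNReal.toReal_mul, Measure.real, ENNReal.toReal_ofReal] using this

/-- Comparison of the law of `A *ᵥ u` with a product of Gaussians of smaller variance. -/
lemma le_map_mulVec_stdGaussianPi {κ : Type*} [Fintype κ] [DecidableEq κ]
    {A : Matrix κ κ ℝ} (hA : A.det ≠ 0) {v : NNReal} (hv : v ≠ 0)
    (h : ∀ u, v * ∑ i, u i ^ 2 ≤ ∑ i, (A.mulVec u) i ^ 2) {s : Set (κ → ℝ)}
    (hs : MeasurableSet s) :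
    √v ^ Fintype.card κ * (Measure.pi fun _ : κ => gaussianReal 0 v).real s ≤
      |A.det| * (stdGaussianPi κ).real ((fun u => A.mulVec u) ⁻¹' s) := by
  have hm := measurable_mulVec A
  have key : ENNReal.ofReal (√v ^ Fintype.card κ) * (Measure.pi fun _ : κ => gaussianReal 0 v) s ≤
      ENNReal.ofReal |A.det| * (stdGaussianPi κ) ((fun u => A.mulVec u) ⁻¹' s) := by
    rw [pi_gaussianReal_apply_eq_lintegral_mulVec hA hv hs, stdGaussianPi,
      pi_gaussianReal_eq_withDensity one_ne_zero, withDensity_apply _ (hm hs), mul_left_comm,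
      ← lintegral_const_mul' (ENNReal.ofReal (√v ^ Fintype.card κ)) _ ENNReal.ofReal_ne_top]
    gcongr with u
    rw [← ENNReal.ofReal_mul (by positivity)]
    apply ENNReal.ofReal_le_ofReal
    rw [← mul_assoc, ← mul_pow]
    have hv0 : (0 : ℝ) < v := by positivity
    have e : √v * (√(2 * Real.pi * v))⁻¹ = (√(2 * Real.pi * (1 : NNReal)))⁻¹ := by
      rw [Real.sqrt_mul (by positivity)]
      have : √(v : ℝ) ≠ 0 := by positivity
      field_simp
      simp
    rw [e]
    refine mul_le_mul_of_nonneg_left (Real.exp_le_exp.mpr ?_) (by positivity)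
    rw [div_le_div_iff₀ (by positivity) (by simp)]
    push_cast
    nlinarith [h u]
  have := ENNReal.toReal_mono (by finiteness) key
  simpa [ENNReal.toReal_mul, Measure.real, ENNReal.toReal_ofReal] using this

lemma measurableSet_orthant {κ : Type*} [Fintype κ] (val : κ → Bool) :
    MeasurableSet {w : κ → ℝ | ∀ i, sgnBit (w i) = val i} := by
  have : {w : κ → ℝ | ∀ i, sgnBit (w i) = val i} =
      Set.univ.pi fun i => sgnBit ⁻¹' {val i} := by ext; simp
  rw [this]
  exact MeasurableSet.univ_pi fun i => measurable_sgnBit (measurableSet_singleton _)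

-- The positive semidefinite square root serves as `A`. Being square, it can replace the rectangular
-- `L` in a change of variables, and the second identity makes `|A u|²` the quadratic form of the
-- covariance.
open scoped MatrixOrder in
lemma exists_sq_root_of_mul_transpose {ι κ : Type*} [Fintype ι] [Fintype κ] [DecidableEq κ]
    (L : Matrix κ ι ℝ) :
    ∃ A : Matrix κ κ ℝ, L * L.transpose = A * A.transpose ∧
      A.transpose * A = L * L.transpose := by
  have hS : (L * L.transpose).PosSemidef := by
    simpa using Matrix.posSemidef_self_mul_conjTranspose L
  have hT : (CFC.sqrt (L * L.transpose)).transpose = CFC.sqrt (L * L.transpose) := by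
    have := (CFC.sqrt_nonneg (L * L.transpose)).isSelfAdjoint
    have h2 := this.star_eq
    rwa [Matrix.star_eq_conjTranspose, Matrix.conjTranspose_eq_transpose_of_trivial] at h2
  have h3 := CFC.sqrt_mul_sqrt_self _ hS.nonneg
  exact ⟨CFC.sqrt (L * L.transpose), by rw [hT, h3], by rw [hT, h3]⟩

/-- A nearly uncorrelated Gaussian vector has nearly independent signs. -/
lemma abs_orthant_sub_one_le {ι κ : Type*} [Fintype ι] [Fintype κ] (L : Matrix κ ι ℝ)
    {δ : ℝ} (hdiag : ∀ i, (L * L.transpose) i i = 1)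
    (hoff : ∀ i j, i ≠ j → |(L * L.transpose) i j| ≤ δ) (hδ : 0 ≤ δ)
    (hk : (Fintype.card κ : ℝ) ^ 2 * δ ≤ 1 / 4) (val : κ → Bool) :
    |2 ^ Fintype.card κ * (stdGaussianPi ι).real {v | ∀ i, sgnBit (L.mulVec v i) = val i} - 1| ≤
      4 * (Fintype.card κ : ℝ) ^ 2 * δ := by
  classical
  obtain ⟨A, hA1, hA2⟩ := exists_sq_root_of_mul_transpose L
  set k := Fintype.card κ with hkdef
  rcases Nat.eq_zero_or_pos k with hk0 | hkpos
  · have : IsEmpty κ := Fintype.card_eq_zero_iff.mp hk0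
    simp [hk0]
  have hk1 : (1 : ℝ) ≤ k := by exact_mod_cast hkpos
  -- By Cauchy–Schwarz, `e` bounds the operator norm of `L Lᵀ - 1`.
  set e : ℝ := k * δ with he
  have he0 : 0 ≤ e := by positivity
  have hke : k * e ≤ 1 / 4 := by rw [he]; nlinarith
  have he4 : e ≤ 1 / 4 := by nlinarith
  have hsq : ∀ u : κ → ℝ, |∑ i, (A.mulVec u) i ^ 2 - ∑ i, u i ^ 2| ≤ e * ∑ i, u i ^ 2 := by
    intro u
    have h1 : ∑ i, (A.mulVec u) i ^ 2 = ∑ i, ∑ j, u i * (L * L.transpose) i j * u j := by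
      have : ∑ i, (A.mulVec u) i ^ 2 = dotProduct (A.mulVec u) (A.mulVec u) := by
        simp [dotProduct, sq]
      rw [this, Matrix.dotProduct_mulVec, ← Matrix.mulVec_transpose, Matrix.mulVec_mulVec, hA2,
        dotProduct_comm]
      simp [dotProduct, Matrix.mulVec, Finset.mul_sum, mul_assoc]
    have h2 : ∑ i, u i ^ 2 = ∑ i, ∑ j, u i * (1 : Matrix κ κ ℝ) i j * u j := by
      simp [Matrix.one_apply, sq]
    have h3 : |∑ i, (A.mulVec u) i ^ 2 - ∑ i, u i ^ 2| ≤ ∑ i, ∑ j, δ * (|u i| * |u j|) := by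
      rw [h1, h2, ← Finset.sum_sub_distrib]
      refine (Finset.abs_sum_le_sum_abs _ _).trans (Finset.sum_le_sum fun i _ => ?_)
      rw [← Finset.sum_sub_distrib]
      refine (Finset.abs_sum_le_sum_abs _ _).trans (Finset.sum_le_sum fun j _ => ?_)
      have : u i * (L * L.transpose) i j * u j - u i * (1 : Matrix κ κ ℝ) i j * u j =
        ((L * L.transpose) i j - (1 : Matrix κ κ ℝ) i j) * (u i * u j) := by ring
      rw [this, abs_mul, abs_mul (u i)]
      gcongr
      by_cases hij : i = j
      · subst hij; simp [hdiag, hδ]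
      · simpa [Matrix.one_apply_ne hij] using hoff i j hij
    refine h3.trans ?_
    have h4 : ∑ i, ∑ j, δ * (|u i| * |u j|) = δ * (∑ i, |u i|) ^ 2 := by
      rw [sq, Finset.sum_mul_sum]; simp [Finset.mul_sum]
    have h5 := sq_sum_le_card_mul_sum_sq (s := (Finset.univ : Finset κ)) (f := fun i => |u i|)
    simp only [sq_abs, Finset.card_univ, ← hkdef] at h5
    rw [h4, he]
    nlinarith
  obtain ⟨lo, hlo⟩ : ∃ lo : NNReal, (lo : ℝ) = 1 - e := ⟨⟨1 - e, by linarith⟩, rfl⟩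
  obtain ⟨hi, hhi⟩ : ∃ hi : NNReal, (hi : ℝ) = 1 + e := ⟨⟨1 + e, by linarith⟩, rfl⟩
  have hlo0 : lo ≠ 0 := by
    rintro rfl; rw [NNReal.coe_zero] at hlo; linarith
  have hhi0 : hi ≠ 0 := by
    rintro rfl; rw [NNReal.coe_zero] at hhi; linarith
  have hL : ∀ u, lo * ∑ i, u i ^ 2 ≤ ∑ i, (A.mulVec u) i ^ 2 := by
    intro u
    have := (abs_le.mp (hsq u)).1
    rw [hlo]; linarith
  have hH : ∀ u, ∑ i, (A.mulVec u) i ^ 2 ≤ hi * ∑ i, u i ^ 2 := by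
    intro u
    have := (abs_le.mp (hsq u)).2
    rw [hhi]; linarith
  have hdet : A.det ≠ 0 := by
    intro h
    obtain ⟨u, hu, hu0⟩ := Matrix.exists_mulVec_eq_zero_iff.mpr h
    have h1 := hL u
    rw [hu0] at h1
    obtain ⟨i, hi'⟩ := Function.ne_iff.mp hu
    have h2 : 0 < ∑ i, u i ^ 2 :=
      Finset.sum_pos' (fun _ _ => sq_nonneg _) ⟨i, Finset.mem_univ _, by
        have : u i ≠ 0 := hi'
        positivity⟩
    have h3 : (0 : ℝ) < lo := by positivity
    simp at h1
    have := mul_pos h3 h2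
    linarith
  have hD : 0 < |A.det| := abs_pos.mpr hdet
  have hO := measurableSet_orthant val
  have hlaw : (stdGaussianPi ι).real {v | ∀ i, sgnBit (L.mulVec v i) = val i} =
      (stdGaussianPi κ).real ((fun u => A.mulVec u) ⁻¹' {w | ∀ i, sgnBit (w i) = val i}) := by
    rw [← map_measureReal_apply (measurable_mulVec A) hO, ← map_mulVec_stdGaussianPi_congr L A hA1,
      map_measureReal_apply (measurable_mulVec L) hO]
    rfl
  have hhalf : ∀ v : NNReal, v ≠ 0 → (Measure.pi fun _ : κ => gaussianReal 0 v).real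
      {w | ∀ i, sgnBit (w i) = val i} = (1 / 2) ^ k := by
    intro v hv
    rw [Measure.real, pi_gaussianReal_orthant hv]; simp [hkdef]
  rw [hlaw]
  have a1 := map_mulVec_stdGaussianPi_le hdet hhi0 hH hO
  have a2 := le_map_mulVec_stdGaussianPi hdet hlo0 hL hO
  -- Taking the whole space as the event bounds `|A.det|` between the same two powers, so the
  -- determinant never has to be computed.
  have b1 := map_mulVec_stdGaussianPi_le hdet hhi0 hH MeasurableSet.univ
  have b2 := le_map_mulVec_stdGaussianPi hdet hlo0 hL MeasurableSet.univ
  rw [hhalf _ hhi0, ← hkdef] at a1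
  rw [hhalf _ hlo0, ← hkdef] at a2
  simp only [Set.preimage_univ, probReal_univ, mul_one, ← hkdef] at b1 b2
  set p := (stdGaussianPi κ).real ((fun u => A.mulVec u) ⁻¹' {w | ∀ i, sgnBit (w i) = val i})
  have hq : (2 : ℝ) ^ k * (1 / 2) ^ k = 1 := by rw [← mul_pow]; norm_num
  set r := (2 : ℝ) ^ k * p with hr
  set x := √(lo : ℝ) with hx
  set y := √(hi : ℝ) with hy
  have a1' : |A.det| * r ≤ y ^ k := by
    calc |A.det| * r = 2 ^ k * (|A.det| * p) := by rw [hr]; ring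
      _ ≤ 2 ^ k * (y ^ k * (1 / 2) ^ k) := by gcongr
      _ = y ^ k := by rw [mul_left_comm, hq, mul_one]
  have a2' : x ^ k ≤ |A.det| * r := by
    calc x ^ k = 2 ^ k * (x ^ k * (1 / 2) ^ k) := by rw [mul_left_comm, hq, mul_one]
      _ ≤ 2 ^ k * (|A.det| * p) := by gcongr
      _ = _ := by rw [hr]; ring
  have hx0 : 0 < x := by positivity
  have hy0 : 0 < y := by positivity
  -- Squared, this is `(1 - 2e)² (1 + e) ≤ 1 - e`, which reduces to `4e³ ≤ 2e`. Bernoulli's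
  -- inequality then handles the `k`-th power.
  have hxy : (1 - 2 * e) * y ≤ x := by
    rw [hx, hy]
    apply Real.le_sqrt_of_sq_le
    rw [mul_pow, Real.sq_sqrt (by positivity)]
    rw [hlo, hhi]
    nlinarith [mul_nonneg he0 he0, mul_nonneg (mul_nonneg he0 he0) he0]
  have hpow : (1 - 2 * k * e) * y ^ k ≤ x ^ k := by
    calc (1 - 2 * k * e) * y ^ k ≤ (1 - 2 * e) ^ k * y ^ k := by
          gcongr
          have := one_add_mul_le_pow (a := -(2 * e)) (by linarith) k
          calc 1 - 2 * k * e = 1 + k * -(2 * e) := by ring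
            _ ≤ _ := this
            _ = _ := by ring
      _ = ((1 - 2 * e) * y) ^ k := by rw [mul_pow]
      _ ≤ x ^ k := by
          gcongr
          have : 0 ≤ 1 - 2 * e := by linarith
          positivity
  have hyk : 0 < y ^ k := by positivity
  have hr0 : 0 ≤ r := by positivity
  have hc : 4 * (k : ℝ) ^ 2 * δ = 4 * (k * e) := by rw [he]; ring
  set t := k * e with ht
  have ht0 : 0 ≤ t := by positivity
  rw [hc, abs_le]
  rw [show (2 : ℝ) * k * e = 2 * t by rw [ht]; ring] at hpow
  constructor
  · have : (1 - 2 * t) ≤ r := by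
      by_contra hcon
      push Not at hcon
      have h1 : |A.det| * r < y ^ k * (1 - 2 * t) := by
        calc |A.det| * r ≤ y ^ k * r := by gcongr
          _ < _ := by gcongr
      linarith
    linarith
  · have h1 : (1 - 2 * t) * r ≤ 1 := by
      by_contra hcon
      push Not at hcon
      have h2 : y ^ k < |A.det| * r := by
        calc y ^ k < y ^ k * ((1 - 2 * t) * r) := by
              conv_lhs => rw [← mul_one (y ^ k)]
              gcongr
          _ = ((1 - 2 * t) * y ^ k) * r := by ring
          _ ≤ |A.det| * r := by gcongr; linarith
      linarith
    -- For `0 ≤ t ≤ 1/4`, `1 / (1 - 2t) ≤ 1 + 4t`.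
    nlinarith

/-! ### The Hadamard matrix and forrelation as a bilinear form -/

/-- The normalized Hadamard matrix. -/
def hadamard (n : ℕ) : Matrix (Cube n) (Cube n) ℝ :=
  Matrix.of fun y x => 1 / √((2 : ℝ) ^ n) * (-1) ^ dot x y

lemma dot_comm {n : ℕ} (x y : Cube n) : dot x y = dot y x := by
  simp [dot, mul_comm]

/-- Orthogonality of characters: the sum factors over coordinates, and a coordinate where `y` and
`z` differ contributes `1 - 1 = 0`. -/
lemma sum_neg_one_pow_dot_mul {n : ℕ} (y z : Cube n) :
    ∑ x : Cube n, ((-1 : ℝ) ^ dot x y * (-1) ^ dot x z) = if y = z then 2 ^ n else 0 := by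
  have h : ∀ x : Cube n, (-1 : ℝ) ^ dot x y * (-1) ^ dot x z =
      ∏ i, ((-1 : ℝ) ^ ((x i).toNat * (y i).toNat) * (-1) ^ ((x i).toNat * (z i).toNat)) := by
    intro x
    simp only [dot, ← Finset.prod_pow_eq_pow_sum, Finset.prod_mul_distrib]
  simp_rw [h]
  have h2 := Finset.prod_univ_sum (ι := Fin n) (R := ℝ) (fun _ => (Finset.univ : Finset Bool))
    (fun i b => ((-1 : ℝ) ^ (b.toNat * (y i).toNat) * (-1) ^ (b.toNat * (z i).toNat)))
  rw [Fintype.piFinset_univ] at h2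
  rw [← h2]
  split_ifs with hyz
  · subst hyz
    rw [Finset.prod_congr rfl (g := fun _ => (2 : ℝ))]
    · simp
    · intro i _
      cases y i <;> norm_num
  · obtain ⟨i, hi⟩ := Function.ne_iff.mp hyz
    refine Finset.prod_eq_zero (Finset.mem_univ i) ?_
    revert hi
    cases y i <;> cases z i <;> simp

lemma hadamard_transpose (n : ℕ) : (hadamard n).transpose = hadamard n := by
  ext x y
  simp [hadamard, dot_comm]

lemma hadamard_mul_self (n : ℕ) : hadamard n * hadamard n = 1 := by
  ext y z
  simp only [Matrix.mul_apply, hadamard, Matrix.of_apply, Matrix.one_apply]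
  have h := sum_neg_one_pow_dot_mul y z
  have : ∀ x : Cube n, 1 / √((2 : ℝ) ^ n) * (-1) ^ dot x y * (1 / √((2 : ℝ) ^ n) * (-1) ^ dot z x)
      = 1 / 2 ^ n * ((-1 : ℝ) ^ dot x y * (-1) ^ dot x z) := by
    intro x
    have : (1 / √((2 : ℝ) ^ n)) * (1 / √((2 : ℝ) ^ n)) = 1 / 2 ^ n := by
      rw [div_mul_div_comm, Real.mul_self_sqrt (by positivity), one_mul]
    rw [dot_comm z x, ← this]
    ring
  simp_rw [this, ← Finset.mul_sum, h]
  split_ifs <;> simp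

lemma abs_hadamard (n : ℕ) (y x : Cube n) : |hadamard n y x| = 1 / √((2 : ℝ) ^ n) := by
  simp [hadamard, abs_mul, abs_pow]

lemma fourierTransform_eq_mulVec {n : ℕ} (v : Cube n → ℝ) :
    fourierTransform v = (hadamard n).mulVec v := by
  ext y
  simp [fourierTransform, hadamard, Matrix.mulVec, dotProduct, Finset.mul_sum, mul_assoc]

lemma hadamard_dotProduct_mulVec {n : ℕ} (u v : Cube n → ℝ) :
    dotProduct ((hadamard n).mulVec u) ((hadamard n).mulVec v) = dotProduct u v := by
  rw [Matrix.dotProduct_mulVec, ← Matrix.mulVec_transpose, Matrix.mulVec_mulVec,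
    hadamard_transpose, hadamard_mul_self, Matrix.one_mulVec]

lemma sum_sq_hadamard_mulVec {n : ℕ} (u : Cube n → ℝ) :
    ∑ y, ((hadamard n).mulVec u y) ^ 2 = ∑ x, u x ^ 2 := by
  have := hadamard_dotProduct_mulVec u u
  simpa [dotProduct, sq] using this

lemma phi_eq {n : ℕ} (f g : Cube n → ℝ) :
    phi f g = 1 / 2 ^ n * dotProduct g ((hadamard n).mulVec f) := by
  have h : (2 : ℝ) ^ (3 * (n : ℝ) / 2) = 2 ^ n * √(2 ^ n) := by
    rw [Real.sqrt_eq_rpow, ← Real.rpow_natCast, ← Real.rpow_mul (by norm_num),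
      ← Real.rpow_add (by norm_num)]
    congr 1; ring
  rw [phi, h, Finset.sum_comm]
  simp only [dotProduct, Matrix.mulVec, hadamard, Matrix.of_apply, Finset.mul_sum]
  refine Finset.sum_congr rfl fun y _ => Finset.sum_congr rfl fun x _ => ?_
  field_simp

lemma phi_eq' {n : ℕ} (f g : Cube n → ℝ) :
    phi f g = 1 / 2 ^ n * dotProduct f ((hadamard n).mulVec g) := by
  rw [phi_eq, Matrix.dotProduct_mulVec, ← Matrix.mulVec_transpose, hadamard_transpose,
    dotProduct_comm]

lemma spin_sq (b : Bool) : spin b ^ 2 = 1 := by cases b <;> simp [spin]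

lemma spin_sgnBit_mul (a : ℝ) : spin (sgnBit a) * a = |a| := by
  rw [spin_sgnBit]
  split_ifs with h
  · rw [abs_of_nonneg h, one_mul]
  · rw [abs_of_neg (not_le.mp h), neg_one_mul]

/-- If `v` and its transform are both close to their sign vectors, then the sign vectors are
correlated. -/
lemma le_phiString_forrelatedString {n : ℕ} (v : Cube n → ℝ) :
    2 ^ n - ∑ x, (1 - 0.8 * |v x|) ^ 2 - ∑ y, (1 - 0.8 * |fourierTransform v y|) ^ 2 ≤
      2 ^ n * phiString (forrelatedString v) := by
  have hs : ∀ a : ℝ, (1 - 0.8 * |a|) ^ 2 = (spin (sgnBit a) - 0.8 * a) ^ 2 := by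
    intro a
    have h1 := spin_sq (sgnBit a)
    have h2 := spin_sgnBit_mul a
    have h3 := sq_abs a
    nlinarith
  simp_rw [hs, phiString, phi_eq, fourierTransform_eq_mulVec]
  simp only [forrelatedString, Sum.elim_inl, Sum.elim_inr, fourierTransform_eq_mulVec]
  set f : Cube n → ℝ := fun x => spin (sgnBit (v x)) with hf
  set w := (hadamard n).mulVec v with hw
  set g : Cube n → ℝ := fun y => spin (sgnBit (w y)) with hg
  -- Parseval moves the error of `f` to the Fourier side, where both `H f` and `g` are compared with
  -- `0.8 w`.
  have hpar : ∑ x, (spin (sgnBit (v x)) - 0.8 * v x) ^ 2 =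
      ∑ y, ((hadamard n).mulVec f y - 0.8 * w y) ^ 2 := by
    rw [← sum_sq_hadamard_mulVec (fun x => spin (sgnBit (v x)) - 0.8 * v x)]
    have : (fun x => spin (sgnBit (v x)) - 0.8 * v x) = f - (0.8 : ℝ) • v := by
      ext x; simp [hf]
    rw [this, Matrix.mulVec_sub, Matrix.mulVec_smul]
    simp [hw]
  have hF : ∑ y, ((hadamard n).mulVec f y) ^ 2 = 2 ^ n := by
    rw [sum_sq_hadamard_mulVec]
    simp [hf, spin_sq]
  have hG : ∑ y : Cube n, (g y) ^ 2 = 2 ^ n := by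
    simp [hg, spin_sq]
  rw [hpar, ← mul_assoc, mul_one_div_cancel (by positivity), one_mul, dotProduct]
  -- This is `(a - b)² / 2 ≤ (a - c)² + (b - c)²` with `a = H f`, `b = g`, `c = 0.8 w`.
  have hpt : ∀ y, ((hadamard n).mulVec f y) ^ 2 / 2 + g y ^ 2 / 2 - g y * (hadamard n).mulVec f y ≤
      ((hadamard n).mulVec f y - 0.8 * w y) ^ 2 + (g y - 0.8 * w y) ^ 2 := by
    intro y
    nlinarith [sq_nonneg (((hadamard n).mulVec f y - 0.8 * w y) + (g y - 0.8 * w y))]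
  have := Finset.sum_le_sum fun y (_ : y ∈ Finset.univ) => hpt y
  simp only [Finset.sum_add_distrib, Finset.sum_sub_distrib, ← Finset.sum_div, hF, hG] at this
  simp only [hg] at this ⊢
  linarith

/-! ### Large deviations of the sign error -/

lemma integral_abs_gaussianReal : ∫ x, |x| ∂(gaussianReal 0 1) = √(2 / Real.pi) := by
  rw [integral_gaussianReal_eq_integral_smul one_ne_zero]
  have h1 : ∀ x : ℝ, gaussianPDFReal 0 1 x • |x| =
      (√(2 * Real.pi))⁻¹ * (|x| ^ (1 : ℝ) * Real.exp (-(1 / 2) * |x| ^ (2 : ℝ))) := by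
    intro x
    simp [gaussianPDFReal]
    ring_nf
  simp_rw [h1]
  rw [integral_const_mul,
    integral_comp_abs (f := fun x => x ^ (1 : ℝ) * Real.exp (-(1 / 2) * x ^ (2 : ℝ))),
    integral_rpow_mul_exp_neg_mul_rpow (by norm_num) (by norm_num) (by norm_num)]
  norm_num
  have h2 : √(2 : ℝ) ^ 2 = 2 := Real.sq_sqrt (by norm_num)
  field_simp
  rw [h2]

lemma integrable_exp_mul_sq_gaussianReal {c : ℝ} (hc : c < 1 / 2) :
    Integrable (fun x => Real.exp (c * x ^ 2)) (gaussianReal 0 1) := by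
  rw [gaussianReal_of_var_ne_zero _ one_ne_zero, gaussianPDF_def,
    integrable_withDensity_iff_integrable_smul₀'
      (by fun_prop) (by filter_upwards with x; exact ENNReal.ofReal_lt_top)]
  have h : ∀ x : ℝ, (ENNReal.ofReal (gaussianPDFReal 0 1 x)).toReal • Real.exp (c * x ^ 2) =
      (√(2 * Real.pi))⁻¹ * Real.exp (-(1 / 2 - c) * x ^ 2) := by
    intro x
    rw [ENNReal.toReal_ofReal (gaussianPDFReal_nonneg _ _ _)]
    simp only [gaussianPDFReal, NNReal.coe_one, mul_one, sub_zero, smul_eq_mul, mul_assoc,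
      ← Real.exp_add]
    ring_nf
  simp_rw [h]
  exact (integrable_exp_neg_mul_sq (by linarith)).const_mul _

/-- Squared distance of a multiple of a Gaussian from its sign, shifted to have negative mean. -/
def signError (t : ℝ) : ℝ := (1 - 0.8 * |t|) ^ 2 - 0.465

lemma measurable_signError : Measurable signError := by
  unfold signError; fun_prop

/-- The mean is `0.64 - 1.6 √(2/π) + 0.535`. The factor `0.8` is close to the optimal `√(2/π)`. -/
lemma integral_signError_neg : ∫ x, signError x ∂(gaussianReal 0 1) < 0 := by
  have hi1 : Integrable (fun x : ℝ => |x|) (gaussianReal 0 1) := by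
    have : Integrable (fun x : ℝ => x) (gaussianReal 0 1) := IsGaussian.integrable_fun_id
    exact this.abs
  have hi2 : Integrable (fun x : ℝ => x ^ 2) (gaussianReal 0 1) := by
    have : MemLp (fun x : ℝ => x) 2 (gaussianReal 0 1) := IsGaussian.memLp_two_fun_id
    exact this.integrable_sq
  have h2 : ∫ x, x ^ 2 ∂(gaussianReal 0 1) = 1 := by
    have := variance_fun_id_gaussianReal (μ := 0) (v := 1)
    rw [variance_eq_integral (by fun_prop)] at this
    simpa using this
  have e : ∀ x, signError x = (0.64 * x ^ 2 - 1.6 * |x|) + 0.535 := by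
    intro x
    rw [signError, ← sq_abs x]; ring
  simp_rw [e]
  have hi3 : Integrable (fun x : ℝ => 0.64 * x ^ 2 - 1.6 * |x|) (gaussianReal 0 1) :=
    (hi2.const_mul _).sub (hi1.const_mul _)
  rw [integral_add hi3 (integrable_const _),
    integral_sub (hi2.const_mul _) (hi1.const_mul _), integral_const_mul, integral_const_mul,
    h2, integral_abs_gaussianReal]
  -- This crude bound is enough, since `1.6 * 0.75 = 1.2` exceeds `0.64 + 0.535 = 1.175`.
  have : (0.75 : ℝ) < √(2 / Real.pi) := by
    apply Real.lt_sqrt_of_sq_lt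
    rw [lt_div_iff₀ Real.pi_pos]
    nlinarith [Real.pi_lt_d2]
  generalize √(2 / Real.pi) = s at this
  simp
  linarith

lemma integrable_exp_mul_signError {t : ℝ} (h : |t| < 1 / 8) :
    Integrable (fun x => Real.exp (t * signError x)) (gaussianReal 0 1) := by
  have h1 := (integrable_exp_mul_sq_gaussianReal (c := 1 / 4) (by norm_num)).const_mul (Real.exp 1)
  refine h1.mono' (by have := measurable_signError; fun_prop) ?_
  filter_upwards with x
  rw [Real.norm_eq_abs, abs_of_pos (Real.exp_pos _), ← Real.exp_add]
  apply Real.exp_le_exp.mpr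
  have h3 : |signError x| ≤ 2 + 2 * x ^ 2 := by
    rw [signError, ← sq_abs x, abs_le]
    constructor <;> nlinarith [abs_nonneg x, sq_nonneg (1 - 0.8 * |x|), sq_nonneg (1 + 0.8 * |x|)]
  calc t * signError x ≤ |t * signError x| := le_abs_self _
    _ = |t| * |signError x| := abs_mul _ _
    _ ≤ 1 / 8 * (2 + 2 * x ^ 2) := by gcongr
    _ ≤ _ := by linarith

/-- Some exponential moment of `signError` is less than one. -/
lemma exists_mgf_signError_lt_one :
    ∃ t : ℝ, 0 < t ∧ Integrable (fun x => Real.exp (t * signError x)) (gaussianReal 0 1) ∧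
      ∫ x, Real.exp (t * signError x) ∂(gaussianReal 0 1) < 1 := by
  have h0 : (0 : ℝ) ∈ interior (integrableExpSet signError (gaussianReal 0 1)) := by
    rw [mem_interior]
    refine ⟨Metric.ball 0 (1 / 8), fun t ht => ?_, Metric.isOpen_ball, by simp⟩
    exact integrable_exp_mul_signError (by simpa using ht)
  have hd := hasDerivAt_mgf h0
  simp only [zero_mul, Real.exp_zero, mul_one] at hd
  have hn := integral_signError_neg
  -- The moment generating function equals `1` at `0` and its derivative there is the negative mean,
  -- so it drops below `1` just to the right.
  have hev : ∀ᶠ t in 𝓝[>] (0 : ℝ), mgf signError (gaussianReal 0 1) t < 1 := by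
    have h2 := (hasDerivAt_iff_tendsto_slope.mp hd).eventually (gt_mem_nhds hn)
    have h3 : 𝓝[>] (0 : ℝ) ≤ 𝓝[≠] 0 := nhdsWithin_mono _ fun x hx => ne_of_gt hx
    filter_upwards [h3 h2, self_mem_nhdsWithin] with t ht ht0
    have ht0' : (0 : ℝ) < t := ht0
    rw [slope_def_field, mgf_zero, sub_zero, div_lt_iff₀ ht0', zero_mul] at ht
    linarith
  have hev2 : ∀ᶠ t in 𝓝[>] (0 : ℝ), t < 1 / 8 :=
    (gt_mem_nhds (by norm_num : (0 : ℝ) < 1 / 8)).filter_mono nhdsWithin_le_nhds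
  obtain ⟨t, ht1, ht2, ht3⟩ := (hev.and (hev2.and self_mem_nhdsWithin)).exists
  have ht3' : (0 : ℝ) < t := ht3
  refine ⟨t, ht3', integrable_exp_mul_signError (by rwa [abs_of_pos ht3']), ht1⟩

/-- Chernoff bound: by independence the exponential moment of the sum is the `card ι`-th power of a
single moment below `1`. The base `ρ` does not depend on the dimension. -/
lemma exists_signError_tail :
    ∃ ρ : ℝ, 0 < ρ ∧ ρ < 1 ∧ ∀ {ι : Type} [Fintype ι],
      (Measure.pi fun _ : ι => gaussianReal 0 1).real {v | 0 ≤ ∑ i, signError (v i)} ≤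
        ρ ^ Fintype.card ι := by
  obtain ⟨t, ht, hint, hlt⟩ := exists_mgf_signError_lt_one
  refine ⟨_, integral_exp_pos hint, hlt, fun {ι} _ => ?_⟩
  have hI : Integrable (fun v : ι → ℝ => ∏ i, Real.exp (t * signError (v i)))
      (Measure.pi fun _ : ι => gaussianReal 0 1) := Integrable.fintype_prod fun _ => hint
  have h := mul_meas_ge_le_integral_of_nonneg (Filter.Eventually.of_forall fun v =>
    Finset.prod_nonneg fun i _ => (Real.exp_pos _).le) hI 1
  rw [integral_fintype_prod_eq_pow (f := fun x => Real.exp (t * signError x)), one_mul] at h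
  refine le_trans (measureReal_mono (fun v hv => ?_)) h
  simp only [Set.mem_ofPred_eq] at hv ⊢
  rw [← Real.exp_sum, ← Finset.mul_sum]
  exact Real.one_le_exp (mul_nonneg ht.le hv)

/-! ### Terms under the uniform distribution and under conditioning -/

instance isProbabilityMeasure_uniform (ι : Type*) [Fintype ι] :
    IsProbabilityMeasure (uniform ι) := by
  classical
  exact isProbabilityMeasure_uniformOn Set.finite_univ Set.univ_nonempty

lemma uniform_real_apply {ι : Type*} [Fintype ι] [DecidableEq ι] (s : Set (ι → Bool))
    [DecidablePred (· ∈ s)] :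
    (uniform ι).real s = (Finset.univ.filter (· ∈ s)).card / 2 ^ Fintype.card ι := by
  rw [Measure.real, uniform, uniformOn_univ]
  have : s = ((Finset.univ.filter (· ∈ s) : Finset (ι → Bool)) : Set (ι → Bool)) := by
    ext; simp
  conv_lhs => rw [this]
  rw [Measure.count_apply_finset]
  simp

lemma uniform_real_event {ι : Type*} [Fintype ι] {k : ℕ} (C : KTerm ι k) :
    (uniform ι).real C.event = (1 / 2) ^ k := by
  classical
  rw [uniform_real_apply]
  have h : (Finset.univ.filter (· ∈ C.event)) =
      Fintype.piFinset fun i => if i ∈ C.vars then {C.val i} else Finset.univ := by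
    ext z
    rw [Finset.mem_filter_univ, Fintype.mem_piFinset]
    change (∀ i, i ∈ C.vars → _) ↔ _
    refine forall_congr' fun i => ?_
    split_ifs with hi <;> simp [hi]
  rw [h, Fintype.card_piFinset]
  have h2 : ∀ i, (if i ∈ C.vars then {C.val i} else (Finset.univ : Finset Bool)).card =
      if i ∈ C.vars then 1 else 2 := by
    intro i; split_ifs <;> simp
  simp_rw [h2]
  rw [Finset.prod_ite]
  simp only [Finset.prod_const, one_pow, one_mul]
  have h3 : (Finset.univ.filter (fun i => i ∉ C.vars)).card + k = Fintype.card ι := by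
    have := Finset.card_filter_add_card_filter_not (s := (Finset.univ : Finset ι)) (· ∈ C.vars)
    rw [Finset.card_univ] at this
    have hc := C.card_vars
    simp only [Finset.filter_univ_mem] at this
    omega
  rw [← h3, pow_add]
  push_cast
  rw [one_div_pow]
  field_simp

lemma almostKWiseIndependent_iff {ι : Type*} [Fintype ι] {D : Measure (ι → Bool)} {ε : ℝ} {k : ℕ} :
    AlmostKWiseIndependent D ε k ↔ ∀ C : KTerm ι k, |2 ^ k * D.real C.event - 1| ≤ ε := by
  refine forall_congr' fun C => ?_
  rw [uniform_real_event, abs_le, one_div_pow, div_div_eq_mul_div, div_one, mul_comm]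
  constructor <;> rintro ⟨h1, h2⟩ <;> constructor <;> linarith

lemma AlmostKWiseIndependent.mono {ι : Type*} {D : Measure (ι → Bool)}
    {ε ε' : ℝ} {k : ℕ} (h : AlmostKWiseIndependent D ε k) (hε : ε ≤ ε') :
    AlmostKWiseIndependent D ε' k :=
  fun C => ⟨by linarith [(h C).1], by linarith [(h C).2]⟩

lemma almostKWiseIndependent_uniform {ι : Type*} [Fintype ι] (k : ℕ) :
    AlmostKWiseIndependent (uniform ι) 0 k := by
  rw [almostKWiseIndependent_iff]
  intro C
  rw [uniform_real_event, ← mul_pow]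
  norm_num

/-- Conditioning on an event of overwhelming probability preserves almost `k`-wise independence. -/
lemma AlmostKWiseIndependent.cond {ι : Type*} [Fintype ι] {D : Measure (ι → Bool)}
    [IsProbabilityMeasure D] {η β : ℝ} {k : ℕ} (h : AlmostKWiseIndependent D η k) (hη : η ≤ 1)
    {G : Set (ι → Bool)} (hG : D.real Gᶜ ≤ β) (hβ : β ≤ 1 / 2) :
    IsProbabilityMeasure (ProbabilityTheory.cond D G) ∧
      AlmostKWiseIndependent (ProbabilityTheory.cond D G) (η + 4 * (2 ^ k * β)) k := by
  have hGm : MeasurableSet G := (Set.toFinite G).measurableSet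
  have hg : D.real G = 1 - D.real Gᶜ := by
    rw [probReal_compl_eq_one_sub hGm]; ring
  have hβ0 : 0 ≤ β := measureReal_nonneg.trans hG
  have hg1 : 1 - β ≤ D.real G := by linarith
  have hg0 : 0 < D.real G := by linarith
  have hle : D.real G ≤ 1 := measureReal_le_one
  refine ⟨cond_isProbabilityMeasure fun h0 => ?_, ?_⟩
  · rw [Measure.real, h0] at hg0; simp at hg0
  rw [almostKWiseIndependent_iff] at h ⊢
  intro C
  have hC := abs_le.mp (h C)
  have hcond : (ProbabilityTheory.cond D G).real C.event =
      (D.real G)⁻¹ * D.real (G ∩ C.event) := by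
    simp [Measure.real, cond_apply hGm]
  rw [hcond]
  set p := D.real C.event
  set q := D.real (G ∩ C.event)
  have hq1 : q ≤ p := measureReal_mono Set.inter_subset_right
  -- The absolute loss `β` becomes the relative loss `2 ^ k * β` once multiplied by `T`.
  have hq2 : p ≤ q + β := by
    have : D.real C.event ≤ D.real (G ∩ C.event) + D.real Gᶜ := by
      refine le_trans (measureReal_mono ?_) (measureReal_union_le _ _)
      intro z hz
      by_cases hzG : z ∈ G
      · exact Or.inl ⟨hzG, hz⟩
      · exact Or.inr hzG
    linarith
  have hq0 : 0 ≤ q := measureReal_nonneg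
  have h2k : (1 : ℝ) ≤ 2 ^ k := one_le_pow₀ (by norm_num)
  set T : ℝ := 2 ^ k
  have hTβ : β ≤ T * β := by nlinarith
  rw [abs_le]
  have hinv : T * ((D.real G)⁻¹ * q) = T * q / D.real G := by field_simp
  rw [hinv]
  have hTq : T * p ≤ T * q + T * β := by nlinarith
  have hTq' : T * q ≤ T * p := by nlinarith
  constructor
  · have : T * q ≤ T * q / D.real G := by
      rw [le_div_iff₀ hg0]
      nlinarith [mul_nonneg (by linarith : 0 ≤ T) hq0]
    linarith
  · have : T * q / D.real G ≤ 1 + η + 4 * (T * β) := by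
      rw [div_le_iff₀ hg0]
      have h0 : 0 ≤ 1 + η + 4 * (T * β) := by
        have := (abs_nonneg _).trans (h C)
        nlinarith
      have h4 : (1 + η + 4 * (T * β)) * (1 - β) ≤ (1 + η + 4 * (T * β)) * D.real G := by gcongr
      have h5 : 4 * (T * β) * β ≤ 4 * (T * β) * (1 / 2) := by gcongr
      nlinarith
    linarith

/-! ### Concentration of `Φ` under the uniform distribution -/

/-- For fixed `g`, `N Φ` is a sum of independent signs with coefficients `c = H g`, and `∑ c² = N`
by Parseval. The bound `cosh s ≤ exp (s² / 2)` on each factor makes it subgaussian with variance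
proxy `N`, uniformly in `g`. -/
lemma sum_exp_phiString_le (n : ℕ) (t : ℝ) :
    ∑ z : Index n → Bool, Real.exp (t * (2 ^ n * phiString z)) ≤
      2 ^ Fintype.card (Index n) * Real.exp (t ^ 2 * 2 ^ n / 2) := by
  rw [← (Equiv.sumArrowEquivProdArrow (Cube n) (Cube n) Bool).symm.sum_comp, Fintype.sum_prod_type,
    Finset.sum_comm]
  have inner : ∀ b : Cube n → Bool, ∑ a : Cube n → Bool, Real.exp (t * (2 ^ n * phiString
      ((Equiv.sumArrowEquivProdArrow (Cube n) (Cube n) Bool).symm (a, b)))) ≤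
      2 ^ Fintype.card (Cube n) * Real.exp (t ^ 2 * 2 ^ n / 2) := by
    intro b
    set c := (hadamard n).mulVec (fun y => spin (b y)) with hc
    have hcs : ∑ x, c x ^ 2 = 2 ^ n := by
      rw [hc, sum_sq_hadamard_mulVec]; simp [spin_sq]
    have e : ∀ a : Cube n → Bool, Real.exp (t * (2 ^ n * phiString
        ((Equiv.sumArrowEquivProdArrow (Cube n) (Cube n) Bool).symm (a, b)))) =
        ∏ x, Real.exp (t * (spin (a x) * c x)) := by
      intro a
      rw [phiString, phi_eq', ← mul_assoc ((2 : ℝ) ^ n), mul_one_div_cancel (by positivity),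
        one_mul, ← Real.exp_sum]
      simp [Equiv.sumArrowEquivProdArrow, dotProduct, Finset.mul_sum, hc]
    simp_rw [e]
    have h2 := Finset.prod_univ_sum (ι := Cube n) (R := ℝ) (fun _ => (Finset.univ : Finset Bool))
      (fun x s => Real.exp (t * (spin s * c x)))
    rw [Fintype.piFinset_univ] at h2
    rw [← h2]
    calc ∏ x, ∑ s : Bool, Real.exp (t * (spin s * c x))
        ≤ ∏ x, 2 * Real.exp ((t * c x) ^ 2 / 2) := by
          refine Finset.prod_le_prod (fun x _ => by positivity) fun x _ => ?_
          have := Real.cosh_le_exp_half_sq (t * c x)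
          rw [Real.cosh_eq] at this
          simp [spin]
          linarith
      _ = _ := by
          rw [Finset.prod_mul_distrib, ← Real.exp_sum, ← Finset.sum_div]
          simp_rw [mul_pow, ← Finset.mul_sum, hcs]
          simp
  refine (Finset.sum_le_sum fun b _ => inner b).trans ?_
  simp [pow_add, mul_assoc]

lemma uniform_abs_phiString_compl_le (n : ℕ) :
    (uniform (Index n)).real {z | |phiString z| ≤ 0.01}ᶜ ≤
      2 * Real.exp (-(1 / 20000) * 2 ^ n) := by
  classical
  rw [uniform_real_apply, div_le_iff₀ (by positivity)]
  set S := Finset.univ.filter (· ∈ {z : Index n → Bool | |phiString z| ≤ 0.01}ᶜ)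
  -- The Chernoff parameters `±0.01` are optimal for the threshold `0.01`; the resulting exponent is
  -- `(0.0001 - 0.00005) N = N / 20000`.
  have h1 : ∀ z ∈ S, Real.exp (0.0001 * 2 ^ n) ≤ Real.exp (0.01 * (2 ^ n * phiString z)) +
      Real.exp (-0.01 * (2 ^ n * phiString z)) := by
    intro z hz
    simp only [S, Finset.mem_filter, Finset.mem_univ, true_and, Set.mem_compl_iff,
      Set.mem_ofPred_eq, not_le] at hz
    have hN : (0 : ℝ) < 2 ^ n := by positivity
    rcases lt_abs.mp hz with h | h
    · refine le_trans (Real.exp_le_exp.mpr ?_) (le_add_of_nonneg_right (Real.exp_pos _).le)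
      nlinarith
    · refine le_trans (Real.exp_le_exp.mpr ?_) (le_add_of_nonneg_left (Real.exp_pos _).le)
      nlinarith
  have h2 : S.card * Real.exp (0.0001 * 2 ^ n) ≤
      2 * (2 ^ Fintype.card (Index n) * Real.exp (0.01 ^ 2 * 2 ^ n / 2)) := by
    calc S.card * Real.exp (0.0001 * 2 ^ n) = ∑ z ∈ S, Real.exp (0.0001 * 2 ^ n) := by simp
      _ ≤ ∑ z ∈ S, (Real.exp (0.01 * (2 ^ n * phiString z)) +
          Real.exp (-0.01 * (2 ^ n * phiString z))) := Finset.sum_le_sum h1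
      _ ≤ ∑ z, (Real.exp (0.01 * (2 ^ n * phiString z)) +
          Real.exp (-0.01 * (2 ^ n * phiString z))) :=
        Finset.sum_le_sum_of_subset_of_nonneg (Finset.subset_univ _) fun _ _ _ => by positivity
      _ ≤ _ := by
        rw [Finset.sum_add_distrib]
        have a1 := sum_exp_phiString_le n 0.01
        have a2 := sum_exp_phiString_le n (-0.01)
        rw [neg_sq] at a2
        linarith
  have h3 : Real.exp (0.01 ^ 2 * 2 ^ n / 2) =
      Real.exp (-(1 / 20000) * 2 ^ n) * Real.exp (0.0001 * 2 ^ n) := by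
    rw [← Real.exp_add]; ring_nf
  rw [h3] at h2
  have hpos := Real.exp_pos (0.0001 * 2 ^ n)
  refine le_of_mul_le_mul_right ?_ hpos
  linarith

/-! ### The forrelated distribution -/

instance isProbabilityMeasure_forrelated (n : ℕ) : IsProbabilityMeasure (forrelated n) :=
  Measure.isProbabilityMeasure_map (measurable_forrelatedString n).aemeasurable

/-- The transform is orthogonal, so it preserves the standard Gaussian law. Hence one tail bound
serves both `v` and its transform. -/
lemma map_fourierTransform_stdGaussianPi (n : ℕ) :
    (stdGaussianPi (Cube n)).map fourierTransform = stdGaussianPi (Cube n) := by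
  have h := map_mulVec_stdGaussianPi_congr (hadamard n) (1 : Matrix (Cube n) (Cube n) ℝ)
    (by rw [hadamard_transpose, hadamard_mul_self]; simp)
  simp only [Matrix.one_mulVec, Measure.map_id'] at h
  rwa [show (fourierTransform : (Cube n → ℝ) → _) = fun v => (hadamard n).mulVec v from
    funext fun v => fourierTransform_eq_mulVec v]

/-- The forrelation of a forrelated pair is bounded below with overwhelming probability. -/
lemma exists_forrelated_phiString_compl_le :
    ∃ ρ : ℝ, 0 < ρ ∧ ρ < 1 ∧ ∀ n : ℕ,
      (forrelated n).real {z | 0.07 ≤ phiString z}ᶜ ≤ 2 * ρ ^ (2 ^ n) := by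
  obtain ⟨ρ, h0, h1, h⟩ := exists_signError_tail
  refine ⟨ρ, h0, h1, fun n => ?_⟩
  have hc := h (ι := Cube n)
  have hcard : Fintype.card (Cube n) = 2 ^ n := by simp
  rw [hcard] at hc
  set S : Set (Cube n → ℝ) := {v | 0 ≤ ∑ x, signError (v x)} with hS
  have hSm : MeasurableSet S := by
    have := measurable_signError
    exact measurableSet_le measurable_const (by fun_prop)
  have hft : Measurable (fourierTransform : (Cube n → ℝ) → _) := by
    rw [show (fourierTransform : (Cube n → ℝ) → _) = fun v => (hadamard n).mulVec v from
      funext fun v => fourierTransform_eq_mulVec v]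
    exact measurable_mulVec _
  have hc2 : (stdGaussianPi (Cube n)).real (fourierTransform ⁻¹' S) ≤ ρ ^ (2 ^ n) := by
    rw [← map_measureReal_apply hft hSm, map_fourierTransform_stdGaussianPi]
    exact hc
  rw [forrelated, map_measureReal_apply (measurable_forrelatedString n)
    (Set.toFinite _).measurableSet]
  have hsub : forrelatedString ⁻¹' {z : Index n → Bool | 0.07 ≤ phiString z}ᶜ ⊆
      S ∪ fourierTransform ⁻¹' S := by
    intro v hv
    by_contra hcon
    rw [Set.mem_union, not_or] at hcon
    have ha : ∑ x, signError (v x) < 0 := not_le.mp hcon.1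
    have hb : ∑ y, signError (fourierTransform v y) < 0 := not_le.mp hcon.2
    have hz : phiString (forrelatedString v) < 0.07 := not_le.mp hv
    have hm := le_phiString_forrelatedString v
    simp only [signError, Finset.sum_sub_distrib, Finset.sum_const, Finset.card_univ, hcard,
      nsmul_eq_mul] at ha hb
    push_cast at ha hb
    have hN : (0 : ℝ) < 2 ^ n := by positivity
    -- The shift `0.465` in `signError` is chosen so that `1 - 2 * 0.465 = 0.07`.
    nlinarith
  calc _ ≤ (stdGaussianPi (Cube n)).real (S ∪ fourierTransform ⁻¹' S) := measureReal_mono hsub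
    _ ≤ _ := measureReal_union_le _ _
    _ ≤ _ := by linarith [hc, hc2]

/-- The forrelated distribution is almost `k`-wise independent. -/
lemma almostKWiseIndependent_forrelated (n k : ℕ) (hk : (k : ℝ) ^ 2 * (1 / √(2 ^ n)) ≤ 1 / 4) :
    AlmostKWiseIndependent (forrelated n) (4 * (k : ℝ) ^ 2 * (1 / √(2 ^ n))) k := by
  rw [almostKWiseIndependent_iff]
  intro C
  -- Stacking the identity on the Hadamard matrix maps `v` to the pair of `v` and its transform; `L`
  -- keeps the rows that the term reads.
  set M : Matrix (Index n) (Cube n) ℝ := Matrix.fromRows 1 (hadamard n) with hM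
  set L : Matrix C.vars (Cube n) ℝ := M.submatrix (fun i => (i : Index n)) id with hL
  have hLL : ∀ i j, (L * L.transpose) i j = (M * M.transpose) i j := by
    intro i j
    simp [hL, Matrix.mul_apply]
  have hMM : M * M.transpose = Matrix.fromBlocks 1 (hadamard n) (hadamard n) 1 := by
    rw [hM, Matrix.transpose_fromRows, Matrix.fromRows_mul_fromCols, hadamard_transpose,
      hadamard_mul_self]
    simp
  have hcard : Fintype.card C.vars = k := by simp [C.card_vars]
  have hδ : (0 : ℝ) ≤ 1 / √(2 ^ n) := by positivity
  have h := abs_orthant_sub_one_le L (δ := 1 / √(2 ^ n))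
    (by
      intro i
      rw [hLL, hMM]
      rcases i with ⟨i | i, hi⟩ <;> simp)
    (by
      intro i j hij
      rw [hLL, hMM]
      have hij' : (i : Index n) ≠ j := fun h => hij (Subtype.ext h)
      generalize (i : Index n) = a at hij'
      generalize (j : Index n) = b at hij'
      rcases a with a | a <;> rcases b with b | b
      · have : a ≠ b := fun h => hij' (congrArg _ h)
        rw [Matrix.fromBlocks_apply₁₁, Matrix.one_apply_ne this, abs_zero]
        exact hδ
      · rw [Matrix.fromBlocks_apply₁₂, abs_hadamard]
      · rw [Matrix.fromBlocks_apply₂₁, abs_hadamard]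
      · have : a ≠ b := fun h => hij' (congrArg _ h)
        rw [Matrix.fromBlocks_apply₂₂, Matrix.one_apply_ne this, abs_zero]
        exact hδ)
    hδ (by rwa [hcard]) (fun i => C.val i)
  rw [hcard] at h
  rw [forrelated, map_measureReal_apply (measurable_forrelatedString n)
    (Set.toFinite _).measurableSet]
  have hset : forrelatedString ⁻¹' C.event =
      {v : Cube n → ℝ | ∀ i : C.vars, sgnBit (L.mulVec v i) = C.val i} := by
    ext v
    change (∀ i ∈ C.vars, forrelatedString v i = C.val i) ↔
      ∀ i : C.vars, sgnBit (L.mulVec v i) = C.val i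
    rw [Subtype.forall]
    refine forall₂_congr fun i hi => ?_
    have : forrelatedString v i = sgnBit (L.mulVec v ⟨i, hi⟩) := by
      have e : L.mulVec v ⟨i, hi⟩ = M.mulVec v i := rfl
      rw [e, hM, Matrix.fromRows_mulVec, Matrix.one_mulVec, ← fourierTransform_eq_mulVec]
      rcases i with i | i <;> rfl
    rw [this]
  rw [hset]
  exact h

/-! ### Asymptotics in `n` -/

/-- The growth hypothesis is used only through this bound; any fixed exponent below `1/4` would make
`k² N^(-1/2)` vanish. -/
lemma eventually_le_rpow_eighth {k : ℕ → ℕ}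
    (hk : ∃ δ : ℕ → ℝ, Filter.Tendsto δ Filter.atTop (𝓝 0) ∧
      ∀ᶠ n in Filter.atTop, (k n : ℝ) ≤ ((2 : ℝ) ^ n) ^ δ n) :
    ∀ᶠ n in Filter.atTop, (k n : ℝ) ≤ ((2 : ℝ) ^ n) ^ (1 / 8 : ℝ) := by
  obtain ⟨δ, hδ, h⟩ := hk
  filter_upwards [h, hδ.eventually (gt_mem_nhds (by norm_num : (0 : ℝ) < 1 / 8))] with n h1 h2
  exact h1.trans (Real.rpow_le_rpow_of_exponent_le (one_le_pow₀ (by norm_num)) h2.le)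

lemma tendsto_two_pow_atTop : Filter.Tendsto (fun n : ℕ => (2 : ℝ) ^ n) Filter.atTop Filter.atTop :=
  tendsto_pow_atTop_atTop_of_one_lt (by norm_num)

lemma tendsto_sq_mul_inv_sqrt {k : ℕ → ℕ}
    (hk : ∀ᶠ n in Filter.atTop, (k n : ℝ) ≤ ((2 : ℝ) ^ n) ^ (1 / 8 : ℝ)) :
    Filter.Tendsto (fun n => (k n : ℝ) ^ 2 * (1 / √(2 ^ n))) Filter.atTop (𝓝 0) := by
  have h := (tendsto_rpow_neg_atTop (y := 1 / 4) (by norm_num)).comp tendsto_two_pow_atTop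
  refine squeeze_zero' (Filter.Eventually.of_forall fun n => by positivity) ?_ h
  filter_upwards [hk] with n hn
  have hN : (0 : ℝ) < 2 ^ n := by positivity
  calc (k n : ℝ) ^ 2 * (1 / √(2 ^ n)) ≤ (((2 : ℝ) ^ n) ^ (1 / 8 : ℝ)) ^ 2 * (1 / √(2 ^ n)) := by
        gcongr
    _ = ((2 : ℝ) ^ n) ^ (-(1 / 4) : ℝ) := by
        rw [Real.sqrt_eq_rpow, one_div (_ ^ _), ← Real.rpow_neg hN.le, ← Real.rpow_natCast,
          ← Real.rpow_mul hN.le, ← Real.rpow_add hN]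
        norm_num

/-- Since `k` is eventually at most `(c/2) N`, half of the exponential decay absorbs `2 ^ k`. -/
lemma tendsto_two_pow_mul_exp {k : ℕ → ℕ}
    (hk : ∀ᶠ n in Filter.atTop, (k n : ℝ) ≤ ((2 : ℝ) ^ n) ^ (1 / 8 : ℝ)) {c : ℝ} (hc : 0 < c) :
    Filter.Tendsto (fun n => (2 : ℝ) ^ k n * Real.exp (-c * 2 ^ n)) Filter.atTop (𝓝 0) := by
  have h1 : Filter.Tendsto (fun n : ℕ => Real.exp (-(c / 2 * (2 : ℝ) ^ n))) Filter.atTop (𝓝 0) :=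
    Real.tendsto_exp_neg_atTop_nhds_zero.comp
      (tendsto_two_pow_atTop.const_mul_atTop (by positivity))
  refine squeeze_zero' (Filter.Eventually.of_forall fun n => by positivity) ?_ h1
  have h2 := ((tendsto_rpow_neg_atTop (y := 7 / 8) (by norm_num)).comp
    tendsto_two_pow_atTop).eventually (gt_mem_nhds (by positivity : 0 < c / 2))
  filter_upwards [hk, h2] with n hn hn2
  have hN : (0 : ℝ) < 2 ^ n := by positivity
  replace hn2 : ((2 : ℝ) ^ n) ^ (1 / 8 : ℝ) ≤ c / 2 * 2 ^ n := by
    calc ((2 : ℝ) ^ n) ^ (1 / 8 : ℝ) = ((2 : ℝ) ^ n) ^ (-(7 / 8) : ℝ) * 2 ^ n := by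
          rw [← Real.rpow_add_one hN.ne']
          norm_num
      _ ≤ _ := by gcongr; exact hn2.le
  have h3 : (2 : ℝ) ^ k n ≤ Real.exp (k n) := by
    rw [← Real.exp_one_pow]
    gcongr
    linarith [Real.add_one_le_exp (1 : ℝ)]
  calc (2 : ℝ) ^ k n * Real.exp (-c * 2 ^ n) ≤ Real.exp (k n) * Real.exp (-c * 2 ^ n) := by gcongr
    _ ≤ _ := by
      rw [← Real.exp_add]
      apply Real.exp_le_exp.mpr
      linarith

end

end Forrelation

theorem mainTheorem10 (k : ℕ → ℕ)
    (hk : ∃ δ : ℕ → ℝ, Filter.Tendsto δ Filter.atTop (𝓝 0) ∧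
      ∀ᶠ n in Filter.atTop, (k n : ℝ) ≤ ((2 : ℝ) ^ n) ^ δ n) :
    ∃ ε : ℕ → ℝ, Filter.Tendsto ε Filter.atTop (𝓝 0) ∧
      ∀ᶠ n in Filter.atTop,
        (MeasureTheory.IsProbabilityMeasure (Forrelation.forrelatedCond n) ∧
          Forrelation.AlmostKWiseIndependent (Forrelation.forrelatedCond n) (ε n) (k n)) ∧
        (MeasureTheory.IsProbabilityMeasure (Forrelation.uniformCond n) ∧
          Forrelation.AlmostKWiseIndependent (Forrelation.uniformCond n) (ε n) (k n)) := by
  obtain ⟨ρ, hρ0, hρ1, hρ⟩ := Forrelation.exists_forrelated_phiString_compl_le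
  have hk8 := Forrelation.eventually_le_rpow_eighth hk
  -- The smaller of the two decay rates, so that one `β` bounds the failure probability of both
  -- conditioning events.
  set c : ℝ := min (-Real.log ρ) (1 / 20000)
  have hc : 0 < c := lt_min (neg_pos.mpr (Real.log_neg hρ0 hρ1)) (by norm_num)
  set β : ℕ → ℝ := fun n => 2 * Real.exp (-c * 2 ^ n) with hβ
  set η : ℕ → ℝ := fun n => 4 * (k n : ℝ) ^ 2 * (1 / √(2 ^ n)) with hη
  have hη0 : ∀ n, 0 ≤ η n := fun n => by positivity
  have hF : ∀ n, (Forrelation.forrelated n).real {z | 0.07 ≤ Forrelation.phiString z}ᶜ ≤ β n := by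
    intro n
    refine (hρ n).trans ?_
    have : ρ ^ (2 ^ n) = Real.exp (Real.log ρ * 2 ^ n) := by
      have h2 := Real.exp_nat_mul (Real.log ρ) (2 ^ n)
      rw [Real.exp_log hρ0] at h2
      rw [← h2, mul_comm]
      push_cast
      rfl
    rw [this]
    have : Real.log ρ ≤ -c := le_neg_of_le_neg (min_le_left _ _)
    simp only [hβ]
    gcongr
  have hU : ∀ n, (Forrelation.uniform (Forrelation.Index n)).real
      {z | |Forrelation.phiString z| ≤ 0.01}ᶜ ≤ β n := by
    intro n
    refine (Forrelation.uniform_abs_phiString_compl_le n).trans ?_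
    have : c ≤ 1 / 20000 := min_le_right _ _
    simp only [hβ]
    gcongr
  have hβt : Filter.Tendsto (fun n => 2 ^ k n * β n) Filter.atTop (𝓝 0) := by
    have := (Forrelation.tendsto_two_pow_mul_exp hk8 hc).const_mul 2
    rw [mul_zero] at this
    exact this.congr fun n => by simp only [hβ]; ring
  have hηt : Filter.Tendsto η Filter.atTop (𝓝 0) := by
    have := (Forrelation.tendsto_sq_mul_inv_sqrt hk8).const_mul 4
    rw [mul_zero] at this
    exact this.congr fun n => by simp only [hη]; ring
  -- The uniform distribution needs only the second summand; `η` is the error of the unconditioned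
  -- forrelated distribution.
  refine ⟨fun n => η n + 4 * (2 ^ k n * β n), ?_, ?_⟩
  · simpa using hηt.add (hβt.const_mul 4)
  filter_upwards [hηt.eventually (gt_mem_nhds (by norm_num : (0 : ℝ) < 1)),
    hβt.eventually (gt_mem_nhds (by norm_num : (0 : ℝ) < 1 / 2))] with n h1 h2
  have hβn : β n ≤ 1 / 2 := by
    have : (1 : ℝ) ≤ 2 ^ k n := one_le_pow₀ (by norm_num)
    have h0 : 0 ≤ β n := by positivity
    nlinarith
  have hkn : (k n : ℝ) ^ 2 * (1 / √(2 ^ n)) ≤ 1 / 4 := by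
    simp only [hη] at h1
    linarith
  refine ⟨(Forrelation.almostKWiseIndependent_forrelated n (k n) hkn).cond h1.le (hF n) hβn, ?_⟩
  obtain ⟨hp, hi⟩ := (Forrelation.almostKWiseIndependent_uniform (ι := Forrelation.Index n)
    (k n)).cond zero_le_one (hU n) hβn
  exact ⟨hp, hi.mono (by linarith [hη0 n])⟩
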